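/- All graphs are finite, simple, undirected and have at least one vertex. Let $G$ be a graph and let $B\subseteq V(G)$ be a set of blue vertices, all other vertices being white. Under the hopping color change rule, a blue vertex $v$ can force a white vertex $w$ to become blue (written $v\to w$) if $v$ has not yet performed a force and every neighbor of $v$ is blue. A \emph{chronological list of hopping forces} of $B$ is an ordered list of forces, performed one after the other starting from $B$, each one valid when it is performed, and such that no further force is possible at the end; the unordered set of forces in such a list is a \emph{set of hopping forces} of $B$. For a set $\mathcal F$ of hopping forces of $B$, let $\mathcal F^{(0)}=B$ and, for $t>0$, let $\mathcal F^{(t)}$ be the set of vertices $w$ for which there is a force $(v\to w)\in\mathcal F$ that is valid when exactly the vertices of $\bigcup_{i=0}^{t-1}\mathcal F^{(i)}$ are blue. Let $\operatorname{pt}_H(G;\mathcal F)$ be the least $t$ with $\bigcup_{i=0}^{t}\mathcal F^{(i)}=V(G)$ ($\infty$ if there is none), let $\operatorname{pt}_H(G;B)$ be the minimum of $\operatorname{pt}_H(G;\mathcal F)$ over all sets $\mathcal F$ of hopping forces of $B$, and let the hopping throttling number be $\operatorname{th}_H(G)=\min_{B\subseteq V(G)}\bigl(|B|+\operatorname{pt}_H(G;B)\bigr)$.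 For integers $a\ge 1$ and $b\ge 0$, draw the Cartesian product $K_a\,\square\,\overline{K_{b+1}}$ as an array with $a$ rows and $b+1$ columns $0,\dots,b$, in which each column induces a $K_a$ and each row induces a $\overline{K_{b+1}}$. The edges of the copies of $K_a$ are the \emph{complete edges}. An \emph{empty pair} is a pair of vertices in the same row and in two adjacent columns. That $G$ can be obtained from $K_a\,\square\,\overline{K_{b+1}}$ by identifying empty pairs and deleting complete edges means: there are a set $P$ of empty pairs and a set $D$ of complete edges (either may be empty) such that $G$ is isomorphic to the simple graph that results from deleting the edges in $D$ and identifying the two vertices of each pair in $P$, where parallel edges that arise are merged into one. Theorem. Let $G$ be a graph and let $t$ be a positive integer. Then $\operatorname{th}_H(G)\le t$ if and only if there exist integers $a\ge 1$ and $b\ge 0$ such that $a+b=t$ and $G$ can be obtained from $K_a\,\square\,\overline{K_{b+1}}$ by identifying empty pairs and deleting complete edges. -/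

import Mathlib

namespace HoppingForcing

variable {V : Type*}

/-- The hopping color change rule: with `blue` the current set of blue vertices and `done` the set
of vertices that have already performed a force, the blue vertex `v` can force the white vertex
`w` if `v` has yet to perform a force and each vertex of `N(v)` is blue. -/
def CanHop (G : SimpleGraph V) (blue done : Set V) (v w : V) : Prop :=
  v ∈ blue ∧ w ∉ blue ∧ v ∉ done ∧ G.neighborSet v ⊆ blue

/-- The blue vertices after the forces in `L` have been performed, starting from `B`.
A pair `(v, w)` stands for the force `v → w`. -/
def blueAfter (B : Set V) (L : List (V × V)) : Set V :=
  B ∪ {w | ∃ v, (v, w) ∈ L}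

/-- The vertices that have performed a force in `L`. -/
def forcers (L : List (V × V)) : Set V :=
  {v | ∃ w, (v, w) ∈ L}

/-- `L` is a chronological list of hopping forces of `B`: each force is valid after the preceding
ones have been performed, and no force is possible at the end. -/
def IsChronologicalList (G : SimpleGraph V) (B : Set V) (L : List (V × V)) : Prop :=
  (∀ (k : ℕ) (hk : k < L.length),
    CanHop G (blueAfter B (L.take k)) (forcers (L.take k)) L[k].1 L[k].2) ∧
  ∀ v w, ¬ CanHop G (blueAfter B L) (forcers L) v w

/-- `F` is a set of hopping forces of `B`: the unordered set of forces of a chronological list. -/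
def IsSetOfForces (G : SimpleGraph V) (B : Set V) (F : Set (V × V)) : Prop :=
  ∃ L : List (V × V), IsChronologicalList G B L ∧ F = {p | p ∈ L}

/-- The set of vertices that are blue after time step `t`, that is `F⁽⁰⁾ ∪ ⋯ ∪ F⁽ᵗ⁾`, when `F⁽⁰⁾ = B`
and in each time step all the forces of `F` that are currently valid are performed
simultaneously. The vertices that have performed a force so far are the `v` with `(v, w) ∈ F`
for some `w` that is already blue. -/
def blueAt (G : SimpleGraph V) (B : Set V) (F : Set (V × V)) : ℕ → Set V
  | 0 => B
  | t + 1 => blueAt G B F t ∪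
      {w | ∃ v, (v, w) ∈ F ∧
        CanHop G (blueAt G B F t) {x | ∃ y ∈ blueAt G B F t, (x, y) ∈ F} v w}

/-- The hopping propagation time of a set of forces `F` of `B` (`⊤` if the vertex set is never
entirely blue). -/
noncomputable def propTimeOfForces (G : SimpleGraph V) (B : Set V) (F : Set (V × V)) : ℕ∞ :=
  ⨅ (t : ℕ) (_ : blueAt G B F t = Set.univ), (t : ℕ∞)

/-- The hopping propagation time `pt_H(G; B)`: the minimum over all sets of forces of `B`. -/
noncomputable def propTime (G : SimpleGraph V) (B : Set V) : ℕ∞ :=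
  ⨅ (F : Set (V × V)) (_ : IsSetOfForces G B F), propTimeOfForces G B F

/-- The hopping throttling number `th_H(G)`, the minimum of `|B| + pt_H(G; B)`. -/
noncomputable def throttlingNumber (G : SimpleGraph V) : ℕ∞ :=
  ⨅ B : Finset V, ((B.card : ℕ∞) + propTime G (B : Set V))

/-- The Cartesian product of the complete graph `K_a` and the empty graph on `b + 1` vertices.
The vertex `(i, j)` is in row `i` and column `j`. -/
def array (a b : ℕ) : SimpleGraph (Fin a × Fin (b + 1)) :=
  (⊤ : SimpleGraph (Fin a)) □ (⊥ : SimpleGraph (Fin (b + 1)))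

/-- The complete edges: the edges of the copies of `K_a`. -/
def completeEdges (a b : ℕ) : Set (Sym2 (Fin a × Fin (b + 1))) :=
  {e | ∃ (i i' : Fin a) (j : Fin (b + 1)), i ≠ i' ∧ e = s((i, j), (i', j))}

/-- The empty pairs: two vertices in the same row and in adjacent columns, the left one first. -/
def emptyPairs (a b : ℕ) : Set ((Fin a × Fin (b + 1)) × (Fin a × Fin (b + 1))) :=
  {p | p.1.1 = p.2.1 ∧ (p.1.2 : ℕ) + 1 = (p.2.2 : ℕ)}

/-- The equivalence relation generated by a set of pairs that are to be identified. -/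
def identSetoid {W : Type*} (P : Set (W × W)) : Setoid W :=
  Relation.EqvGen.setoid fun u v => (u, v) ∈ P

/-- The simple graph obtained from `H` by identifying the two vertices of each pair in `P`:
distinct classes are adjacent if and only if some representatives are adjacent in `H`. -/
def identify {W : Type*} (H : SimpleGraph W) (P : Set (W × W)) :
    SimpleGraph (Quotient (identSetoid P)) :=
  H.map (Quotient.mk (identSetoid P))

/-- `G` can be obtained, up to isomorphism, from the Cartesian product of `K_a` and the empty graph
on `b + 1` vertices by deleting a set `D` of complete edges and identifying each pair in a set `P` of
empty pairs. -/
def IsObtainable (G : SimpleGraph V) (a b : ℕ) : Prop :=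
  ∃ P ⊆ emptyPairs a b, ∃ D ⊆ completeEdges a b,
    Nonempty (G ≃g identify ((array a b).deleteEdges D) P)

end HoppingForcing

/-!
Both sides of the equivalence say that `G` has a *threading*: `a` rows, each a sequence of vertices
indexed by the columns `0, …, b`, such that distinct rows share no vertex, a vertex occupies an
interval of columns of its row, every vertex occurs, and adjacent vertices meet in a common column.

A threading is the same thing as a presentation of `G` as a quotient of the array
(`isObtainable_iff`): the quotient map is the threading, and conversely one identifies the
consecutive equal entries of each row and deletes the complete edges that join nonadjacent vertices.

If `B` propagates to the whole graph within `b` time steps, then follow the forcing chain of each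
`x ∈ B` and record in column `j` the vertex of the chain that is *active* at time `j`, that is, blue
but yet to perform a force (`chain`). Adjacent vertices meet: in the column in which the later of
the two turns blue, the other one is still active, because a vertex forces only after all its
neighbours are blue (`isThreading_chain`).

Conversely, in a threading let `B` consist of the entries of column `0`, and let each entry of a row
force the next distinct entry of that row (`IsThreading.forces`). The neighbours of a vertex that
leaves its row after column `j` all occur in columns `≤ j`, so that the force is valid as soon as
these columns are blue. Hence the columns turn blue one per time step
(`IsThreading.mem_blueAt`), and the same fact allows the forces to be listed chronologically
(`IsThreading.isSetOfForces`).
-/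

namespace HoppingForcing

variable {V : Type*}

/-! ### Threadings -/

/-- A threading of `G` with rows indexed by `ι` and columns `0, …, b`; `π i j` is the vertex in row
`i` and column `j`. The rows are sequences indexed by all of `ℕ`, but only the columns up to `b` are
required to exhaust the vertices and the adjacencies. -/
structure IsThreading {ι : Type*} (G : SimpleGraph V) (b : ℕ) (π : ι → ℕ → V) : Prop where
  surj : ∀ v, ∃ i, ∃ j ≤ b, π i j = v
  row_eq : ∀ {i i' j j'}, π i j = π i' j' → i = i'
  convex : ∀ {i j j' k}, π i j = π i j' → j ≤ k → k ≤ j' → π i k = π i j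
  adj : ∀ {u v}, G.Adj u v → ∃ i i', ∃ j ≤ b, π i j = u ∧ π i' j = v

lemma IsThreading.comp_equiv {ι κ : Type*} {G : SimpleGraph V} {b : ℕ} {π : ι → ℕ → V}
    (h : IsThreading G b π) (e : κ ≃ ι) : IsThreading G b (fun i => π (e i)) where
  surj v := by
    obtain ⟨i, j, hj, rfl⟩ := h.surj v
    exact ⟨e.symm i, j, hj, by simp⟩
  row_eq hij := e.injective (h.row_eq hij)
  convex := h.convex
  adj huv := by
    obtain ⟨i, i', j, hj, hi, hi'⟩ := h.adj huv
    exact ⟨e.symm i, e.symm i', j, hj, by simpa using hi, by simpa using hi'⟩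

/-! ### Threadings and quotients of the array -/

lemma identify_adj {W : Type*} {H : SimpleGraph W} {P : Set (W × W)}
    {x y : Quotient (identSetoid P)} : (identify H P).Adj x y ↔
      x ≠ y ∧ ∃ u v, H.Adj u v ∧ Quotient.mk _ u = x ∧ Quotient.mk _ v = y :=
  Iff.rfl

/-- The classes of the equivalence relation generated by empty pairs are intervals of rows. -/
lemma eqvGen_emptyPairs {a b : ℕ} {P : Set ((Fin a × Fin (b + 1)) × (Fin a × Fin (b + 1)))}
    (hP : P ⊆ emptyPairs a b) {x y : Fin a × Fin (b + 1)}
    (h : Relation.EqvGen (fun u v => (u, v) ∈ P) x y) :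
    x.1 = y.1 ∧ ∀ k : Fin (b + 1), (x.2 ≤ k ∧ k ≤ y.2 ∨ y.2 ≤ k ∧ k ≤ x.2) →
      Relation.EqvGen (fun u v => (u, v) ∈ P) x (x.1, k) := by
  induction h with
  | rel x y h =>
    obtain ⟨h1, h2⟩ := hP h
    refine ⟨h1, fun k hk => ?_⟩
    have hk' : k = x.2 ∨ k = y.2 := by
      simp only [Fin.ext_iff, Fin.le_def] at *
      omega
    rcases hk' with rfl | rfl
    · exact .refl _
    · rw [h1]
      exact .rel _ _ h
  | refl x =>
    refine ⟨rfl, fun k hk => ?_⟩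
    obtain rfl : k = x.2 := by
      simp only [Fin.ext_iff, Fin.le_def] at *
      omega
    exact .refl _
  | symm x y h ih =>
    refine ⟨ih.1.symm, fun k hk => ?_⟩
    rw [← ih.1]
    exact .trans _ _ _ (.symm _ _ h) (ih.2 k hk.symm)
  | trans x y z hxy _ ih1 ih2 =>
    refine ⟨ih1.1.trans ih2.1, fun k hk => ?_⟩
    have hk' : (x.2 ≤ k ∧ k ≤ y.2 ∨ y.2 ≤ k ∧ k ≤ x.2) ∨
        (y.2 ≤ k ∧ k ≤ z.2 ∨ z.2 ≤ k ∧ k ≤ y.2) := by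
      simp only [Fin.le_def] at *
      omega
    rcases hk' with hk' | hk'
    · exact ih1.2 k hk'
    · rw [ih1.1]
      exact .trans _ _ _ hxy (ih2.2 k hk')

lemma exists_isThreading_of_isObtainable {G : SimpleGraph V} {a b : ℕ} (h : IsObtainable G a b) :
    ∃ π : Fin a → ℕ → V, IsThreading G b π := by
  obtain ⟨P, hP, D, -, ⟨φ⟩⟩ := h
  -- Beyond column `b` the rows are continued by their last entry.
  let c : ℕ → Fin (b + 1) := fun j => ⟨min j b, by omega⟩
  have hc : ∀ j : Fin (b + 1), c j = j := fun j => Fin.ext (by simp [c]; omega)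
  have heq : ∀ {x y : Fin a × Fin (b + 1)},
      φ.symm (Quotient.mk (identSetoid P) x) = φ.symm (Quotient.mk (identSetoid P) y) →
      Relation.EqvGen (fun u v => (u, v) ∈ P) x y := fun h =>
    Quotient.exact (φ.symm.injective h)
  refine ⟨fun i j => φ.symm (Quotient.mk _ (i, c j)), ⟨fun v => ?_, fun hij => ?_,
    fun hij h1 h2 => ?_, fun {u v} huv => ?_⟩⟩
  · obtain ⟨⟨i, j⟩, hx⟩ := Quotient.exists_rep (φ v)
    exact ⟨i, j, by omega, by rw [hc, hx]; simp⟩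
  · exact (eqvGen_emptyPairs hP (heq hij)).1
  · refine congrArg φ.symm (Quotient.sound ?_)
    refine Relation.EqvGen.symm _ _ ((eqvGen_emptyPairs hP (heq hij)).2 _ (.inl ⟨?_, ?_⟩)) <;>
    · simp only [c, Fin.le_def]
      omega
  · have huv' := φ.map_adj_iff.2 huv
    rw [identify_adj] at huv'
    obtain ⟨-, ⟨i, j⟩, ⟨i', j'⟩, hxy, hu, hv⟩ := huv'
    have hj : j = j' := by
      have := (SimpleGraph.deleteEdges_adj.1 hxy).1
      rw [array, SimpleGraph.boxProd_adj] at this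
      simpa using this.elim (fun h => h.2) (fun h => absurd h.1 (by simp))
    subst hj
    exact ⟨i, i', j, by omega, by rw [hc, hu]; simp, by rw [hc, hv]; simp⟩

lemma IsThreading.isObtainable {G : SimpleGraph V} {a b : ℕ} {π : Fin a → ℕ → V}
    (h : IsThreading G b π) : IsObtainable G a b := by
  let f : Fin a × Fin (b + 1) → V := fun x => π x.1 x.2
  let P : Set ((Fin a × Fin (b + 1)) × (Fin a × Fin (b + 1))) :=
    {p | p ∈ emptyPairs a b ∧ f p.1 = f p.2}
  let D : Set (Sym2 (Fin a × Fin (b + 1))) :=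
    {e | e ∈ completeEdges a b ∧ Sym2.map f e ∉ G.edgeSet}
  have hsound : ∀ x y, Relation.EqvGen (fun u v => (u, v) ∈ P) x y → f x = f y := by
    intro x y hxy
    induction hxy with
    | rel _ _ h => exact h.2
    | refl _ => rfl
    | symm _ _ _ ih => exact ih.symm
    | trans _ _ _ _ _ ih1 ih2 => exact ih1.trans ih2
  -- By convexity, two equal entries of a row are joined by consecutive equal entries.
  have hrow : ∀ (i : Fin a) (n j : ℕ) (hj : j < b + 1) (hn : j + n < b + 1),
      π i j = π i (j + n) →
        Relation.EqvGen (fun u v => (u, v) ∈ P) (i, ⟨j, hj⟩) (i, ⟨j + n, hn⟩) := by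
    intro i n
    induction n with
    | zero => exact fun j hj hn _ => .refl _
    | succ n ih =>
      intro j hj hn hπ
      have hmid : π i (j + n) = π i j := h.convex hπ (by omega) (by omega)
      refine .trans _ _ _ (ih j hj (by omega) hmid.symm) (.rel _ _ ⟨⟨rfl, ?_⟩, ?_⟩)
      · simp only
        omega
      · exact hmid.trans hπ
  have hexact : ∀ x y, f x = f y → Relation.EqvGen (fun u v => (u, v) ∈ P) x y := by
    rintro ⟨i, j, hj⟩ ⟨i', j', hj'⟩ hxy
    obtain rfl : i = i' := h.row_eq hxy
    rcases le_total j j' with hle | hle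
    · obtain ⟨n, rfl⟩ := Nat.exists_eq_add_of_le hle
      exact hrow i n j hj hj' hxy
    · obtain ⟨n, rfl⟩ := Nat.exists_eq_add_of_le hle
      exact .symm _ _ (hrow i n j' hj' hj hxy.symm)
  let g : Quotient (identSetoid P) → V := Quotient.lift f hsound
  have hg : Function.Bijective g := by
    constructor
    · intro x y
      induction x using Quotient.inductionOn
      induction y using Quotient.inductionOn
      exact fun hxy => Quotient.sound (hexact _ _ hxy)
    · intro v
      obtain ⟨i, j, hj, rfl⟩ := h.surj v
      exact ⟨Quotient.mk _ (i, ⟨j, by omega⟩), rfl⟩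
  refine ⟨P, fun p hp => hp.1, D, fun e he => he.1, ⟨RelIso.symm ⟨Equiv.ofBijective g hg, ?_⟩⟩⟩
  intro x y
  rw [identify_adj]
  constructor
  · intro hxy
    refine ⟨fun hne => G.ne_of_adj hxy (congrArg _ hne), ?_⟩
    obtain ⟨i, i', j, hj, hi, hi'⟩ := h.adj hxy
    refine ⟨(i, ⟨j, by omega⟩), (i', ⟨j, by omega⟩), ?_, hg.1 hi, hg.1 hi'⟩
    have hii' : i ≠ i' := by
      rintro rfl
      exact G.ne_of_adj hxy (hi.symm.trans hi')
    rw [SimpleGraph.deleteEdges_adj, array, SimpleGraph.boxProd_adj]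
    refine ⟨.inl ⟨hii', rfl⟩, fun hD => hD.2 ?_⟩
    change G.Adj (π i j) (π i' j)
    rw [hi, hi']
    exact hxy
  · rintro ⟨-, ⟨i, j⟩, ⟨i', j'⟩, hadj, rfl, rfl⟩
    rw [SimpleGraph.deleteEdges_adj, array, SimpleGraph.boxProd_adj] at hadj
    obtain ⟨hadj, hD⟩ := hadj
    rcases hadj with ⟨hne, hj⟩ | ⟨hbot, -⟩
    · obtain rfl : j = j' := hj
      by_contra hG
      exact hD ⟨⟨i, i', j, hne, rfl⟩, hG⟩
    · exact absurd hbot (by simp)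

lemma isObtainable_iff {G : SimpleGraph V} {a b : ℕ} :
    IsObtainable G a b ↔ ∃ π : Fin a → ℕ → V, IsThreading G b π :=
  ⟨exists_isThreading_of_isObtainable, fun ⟨_, h⟩ => h.isObtainable⟩

/-! ### Sets of hopping forces -/

section Forces

variable {G : SimpleGraph V} {B : Set V} {F : Set (V × V)}

/-- Each vertex forces at most once. -/
lemma IsSetOfForces.target_unique (hF : IsSetOfForces G B F) {v w w' : V} (h : (v, w) ∈ F)
    (h' : (v, w') ∈ F) : w = w' := by
  obtain ⟨L, ⟨hL, -⟩, rfl⟩ := hF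
  obtain ⟨k, hk, hkv⟩ := List.mem_iff_getElem.1 h
  obtain ⟨l, hl, hlv⟩ := List.mem_iff_getElem.1 h'
  -- A vertex that has forced is recorded in `forcers`, and thus cannot force again.
  have key : ∀ (k l : ℕ) (hk : k < L.length) (hl : l < L.length), k < l → L[k].1 ≠ L[l].1 := by
    intro k l hk hl hkl he
    refine (hL l hl).2.2.1 ⟨L[k].2, ?_⟩
    rw [← he, List.mem_take_iff_getElem]
    exact ⟨k, by omega, rfl⟩
  rcases lt_trichotomy k l with hkl | rfl | hkl
  · exact absurd (by rw [hkv, hlv]) (key k l hk hl hkl)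
  · exact congrArg Prod.snd (hkv.symm.trans hlv)
  · exact absurd (by rw [hkv, hlv]) (key l k hl hk hkl)

/-- Each vertex is forced at most once. -/
lemma IsSetOfForces.source_unique (hF : IsSetOfForces G B F) {v v' w : V} (h : (v, w) ∈ F)
    (h' : (v', w) ∈ F) : v = v' := by
  obtain ⟨L, ⟨hL, -⟩, rfl⟩ := hF
  obtain ⟨k, hk, hkv⟩ := List.mem_iff_getElem.1 h
  obtain ⟨l, hl, hlv⟩ := List.mem_iff_getElem.1 h'
  -- A vertex that has been forced is blue, and thus cannot be forced again.
  have key : ∀ (k l : ℕ) (hk : k < L.length) (hl : l < L.length), k < l → L[k].2 ≠ L[l].2 := by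
    intro k l hk hl hkl he
    refine (hL l hl).2.1 (.inr ⟨L[k].1, ?_⟩)
    rw [← he, List.mem_take_iff_getElem]
    exact ⟨k, by omega, rfl⟩
  rcases lt_trichotomy k l with hkl | rfl | hkl
  · exact absurd (by rw [hkv, hlv]) (key k l hk hl hkl)
  · exact congrArg Prod.fst (hkv.symm.trans hlv)
  · exact absurd (by rw [hkv, hlv]) (key l k hl hk hkl)

lemma IsSetOfForces.target_notMem (hF : IsSetOfForces G B F) {v w : V} (h : (v, w) ∈ F) :
    w ∉ B := by
  obtain ⟨L, ⟨hL, -⟩, rfl⟩ := hF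
  obtain ⟨k, hk, hkv⟩ := List.mem_iff_getElem.1 h
  intro hw
  refine (hL k hk).2.1 (.inl ?_)
  rwa [hkv]

lemma blueAt_mono : Monotone (blueAt G B F) :=
  monotone_nat_of_le_succ fun _ => Set.subset_union_left

/-- A forced vertex that is blue turned blue in the time step of its force. -/
lemma IsSetOfForces.exists_canHop (hF : IsSetOfForces G B F) {v w : V} (h : (v, w) ∈ F) {n : ℕ}
    (hw : w ∈ blueAt G B F n) :
    ∃ m < n, v ∈ blueAt G B F m ∧ w ∉ blueAt G B F m ∧ G.neighborSet v ⊆ blueAt G B F m := by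
  induction n with
  | zero => exact absurd hw (hF.target_notMem h)
  | succ n ih =>
    rcases hw with hw | ⟨v', hv', hhop⟩
    · obtain ⟨m, hm, hm'⟩ := ih hw
      exact ⟨m, by omega, hm'⟩
    · obtain rfl := hF.source_unique h hv'
      exact ⟨n, by omega, hhop.1, hhop.2.1, hhop.2.2.2⟩

variable (G B F) in
/-- The vertices that are active at time `n`: blue, but yet to perform a force of `F`. -/
def active (n : ℕ) : Set V :=
  {v | v ∈ blueAt G B F n ∧ ∀ w, (v, w) ∈ F → w ∉ blueAt G B F n}

/-- The times at which a vertex is active form an interval. -/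
lemma active_of_le {v : V} {j k l : ℕ} (hjk : j ≤ k) (hkl : k ≤ l) (hj : v ∈ active G B F j)
    (hl : v ∈ active G B F l) : v ∈ active G B F k :=
  ⟨blueAt_mono hjk hj.1, fun w hw hwk => hl.2 w hw (blueAt_mono hkl hwk)⟩

/-- A vertex is active when it turns blue. -/
lemma IsSetOfForces.mem_active_of_new (hF : IsSetOfForces G B F) {v : V} {n : ℕ}
    (hv : v ∈ blueAt G B F n) (hnew : ∀ m < n, v ∉ blueAt G B F m) : v ∈ active G B F n := by
  refine ⟨hv, fun w hw hwn => ?_⟩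
  obtain ⟨m, hm, hvm, -⟩ := hF.exists_canHop hw hwn
  exact hnew m hm hvm

/-! ### The threading formed by the forcing chains -/

variable (G B F) in
open Classical in
/-- The forcing chain of `x`: in column `j` stands the vertex of the chain that is active at
time `j`. -/
noncomputable def chain (x : V) : ℕ → V
  | 0 => x
  | j + 1 => if h : ∃ w ∈ blueAt G B F (j + 1), (chain x j, w) ∈ F then h.choose else chain x j

lemma chain_succ_of_mem (hF : IsSetOfForces G B F) {x w : V} {j : ℕ}
    (hw : w ∈ blueAt G B F (j + 1)) (h : (chain G B F x j, w) ∈ F) :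
    chain G B F x (j + 1) = w := by
  have hex : ∃ w ∈ blueAt G B F (j + 1), (chain G B F x j, w) ∈ F := ⟨w, hw, h⟩
  rw [chain, dif_pos hex]
  exact hF.target_unique hex.choose_spec.2 h

lemma chain_succ_of_active {x : V} {j : ℕ} (h : chain G B F x j ∈ active G B F (j + 1)) :
    chain G B F x (j + 1) = chain G B F x j := by
  rw [chain, dif_neg]
  rintro ⟨w, hw, hxw⟩
  exact h.2 w hxw hw

lemma chain_mem_active (hF : IsSetOfForces G B F) {x : V} (hx : x ∈ B) (j : ℕ) :
    chain G B F x j ∈ active G B F j := by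
  induction j with
  | zero => exact hF.mem_active_of_new hx (by simp)
  | succ j ih =>
    by_cases hex : ∃ w ∈ blueAt G B F (j + 1), (chain G B F x j, w) ∈ F
    · obtain ⟨w, hw, hxw⟩ := hex
      rw [chain_succ_of_mem hF hw hxw]
      refine hF.mem_active_of_new hw fun m hm hwm => ?_
      exact ih.2 w hxw (blueAt_mono (Nat.lt_succ_iff.1 hm) hwm)
    · have hact : chain G B F x j ∈ active G B F (j + 1) :=
        ⟨blueAt_mono (Nat.le_succ j) ih.1, fun w hw hwj => hex ⟨w, hwj, hw⟩⟩
      rwa [chain_succ_of_active hact]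

/-- A chain stays at a vertex as long as this vertex is active. -/
lemma chain_eq_of_active (hF : IsSetOfForces G B F) {x v : V} (hx : x ∈ B) {j k : ℕ} (hjk : j ≤ k)
    (hj : chain G B F x j = v) (hk : v ∈ active G B F k) : chain G B F x k = v := by
  induction k, hjk using Nat.le_induction with
  | base => exact hj
  | succ k hjk ih =>
    have hj' : v ∈ active G B F j := hj ▸ chain_mem_active hF hx j
    have hxk := ih (active_of_le hjk (Nat.le_succ k) hj' hk)
    rw [chain_succ_of_active (hxk ▸ hk), hxk]

/-- A vertex that is active at time `j` is the entry of some chain in column `j`. -/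
lemma exists_chain_eq (hF : IsSetOfForces G B F) {v : V} {j : ℕ} (hv : v ∈ active G B F j) :
    ∃ x ∈ B, chain G B F x j = v := by
  induction j generalizing v with
  | zero => exact ⟨v, hv.1, rfl⟩
  | succ j ih =>
    by_cases hvj : v ∈ blueAt G B F j
    · obtain ⟨x, hx, hxv⟩ :=
        ih ⟨hvj, fun w hw hwj => hv.2 w hw (blueAt_mono (Nat.le_succ j) hwj)⟩
      exact ⟨x, hx, chain_eq_of_active hF hx (Nat.le_succ j) hxv hv⟩
    · obtain ⟨u, hu, hhop⟩ := hv.1.resolve_left hvj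
      obtain ⟨x, hx, rfl⟩ : ∃ x ∈ B, chain G B F x j = u := by
        refine ih ⟨hhop.1, fun w hw hwj => hvj ?_⟩
        rwa [hF.target_unique hu hw]
      exact ⟨x, hx, chain_succ_of_mem hF hv.1 hu⟩

/-- Distinct chains have distinct entries in each column. -/
lemma chain_injective (hF : IsSetOfForces G B F) {x y : V} (hx : x ∈ B) (hy : y ∈ B) {j : ℕ}
    (h : chain G B F x j = chain G B F y j) : x = y := by
  induction j with
  | zero => exact h
  | succ j ih =>
    -- If one chain moves, then its new entry is not blue at time `j`, so the other one moves too.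
    have key : ∀ z ∈ B, chain G B F z (j + 1) = chain G B F z j ∨
        (chain G B F z j, chain G B F z (j + 1)) ∈ F ∧
          chain G B F z (j + 1) ∉ blueAt G B F j := by
      intro z hz
      by_cases hex : ∃ w ∈ blueAt G B F (j + 1), (chain G B F z j, w) ∈ F
      · obtain ⟨w, hw, hzw⟩ := hex
        rw [chain_succ_of_mem hF hw hzw]
        exact .inr ⟨hzw, (chain_mem_active hF hz j).2 w hzw⟩
      · left
        rw [chain, dif_neg hex]
    have hxj := (chain_mem_active hF hx j).1
    have hyj := (chain_mem_active hF hy j).1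
    rcases key x hx with h1 | ⟨h1, h1'⟩ <;> rcases key y hy with h2 | ⟨h2, h2'⟩
    · exact ih (by rw [← h1, ← h2, h])
    · exact absurd (by rwa [← h, h1]) h2'
    · exact absurd (by rwa [h, h2]) h1'
    · exact ih (hF.source_unique h1 (h ▸ h2))

lemma isThreading_chain (hF : IsSetOfForces G B F) {b : ℕ} (hb : blueAt G B F b = Set.univ) :
    IsThreading G b (fun x : B => chain G B F x) := by
  have hfirst : ∀ v, ∃ n ≤ b, v ∈ blueAt G B F n ∧ ∀ m < n, v ∉ blueAt G B F m := by
    classical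
    intro v
    have hv : v ∈ blueAt G B F b := hb ▸ Set.mem_univ v
    have hex : ∃ n, v ∈ blueAt G B F n := ⟨b, hv⟩
    exact ⟨Nat.find hex, Nat.find_min' hex hv, Nat.find_spec hex, fun m hm => Nat.find_min hex hm⟩
  have hrow : ∀ {x y : B} {j k : ℕ}, j ≤ k → chain G B F x j = chain G B F y k → x = y := by
    intro x y j k hjk h
    refine Subtype.ext (chain_injective hF x.2 y.2 (j := k) ?_)
    exact chain_eq_of_active hF x.2 hjk h (chain_mem_active hF y.2 k)
  -- In the column in which the later one of two neighbours turns blue, both are active.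
  have hadj : ∀ {u v m n}, G.Adj u v → n ≤ b → m ≤ n → u ∈ blueAt G B F m →
      v ∈ blueAt G B F n → (∀ k < n, v ∉ blueAt G B F k) →
      ∃ x y : B, ∃ j ≤ b, chain G B F x j = u ∧ chain G B F y j = v := by
    intro u v m n huv hn hmn hu hv hnew
    have hu' : u ∈ active G B F n := by
      refine ⟨blueAt_mono hmn hu, fun w hw hwn => ?_⟩
      obtain ⟨k, hk, -, -, hN⟩ := hF.exists_canHop hw hwn
      exact hnew k hk (hN huv)
    obtain ⟨x, hx, hxu⟩ := exists_chain_eq hF hu'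
    obtain ⟨y, hy, hyv⟩ := exists_chain_eq hF (hF.mem_active_of_new hv hnew)
    exact ⟨⟨x, hx⟩, ⟨y, hy⟩, n, hn, hxu, hyv⟩
  refine ⟨fun v => ?_, fun {x y j k} h => ?_, fun {x j l k} h h1 h2 => ?_, fun {u v} huv => ?_⟩
  · obtain ⟨n, hn, hv, hnew⟩ := hfirst v
    obtain ⟨x, hx, hxv⟩ := exists_chain_eq hF (hF.mem_active_of_new hv hnew)
    exact ⟨⟨x, hx⟩, n, hn, hxv⟩
  · rcases le_total j k with hjk | hjk
    · exact hrow hjk h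
    · exact (hrow hjk h.symm).symm
  · refine chain_eq_of_active hF x.2 h1 rfl ?_
    refine active_of_le h1 h2 (chain_mem_active hF x.2 j) ?_
    have := chain_mem_active hF x.2 l
    rwa [← h] at this
  · obtain ⟨m, hm, hu, hunew⟩ := hfirst u
    obtain ⟨n, hn, hv, hvnew⟩ := hfirst v
    rcases le_total m n with hmn | hmn
    · exact hadj huv hn hmn hu hv hvnew
    · obtain ⟨x, y, j, hj, hx, hy⟩ := hadj huv.symm hm hmn hv hu hunew
      exact ⟨y, x, j, hj, hy, hx⟩

/-! ### The forces along the rows of a threading -/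

/-- If the forces of a finite set `F` can always be continued until all of them are performed, and
the whole graph is blue then, `F` is a set of hopping forces. -/
lemma isSetOfForces_of_extend (hfin : F.Finite)
    (hext : ∀ L : List (V × V), (∀ p ∈ L, p ∈ F) → (∃ p ∈ F, p ∉ L) →
      ∃ p ∈ F, p ∉ L ∧ CanHop G (blueAfter B L) (forcers L) p.1 p.2)
    (hblue : ∀ w, w ∈ B ∨ ∃ v, (v, w) ∈ F) : IsSetOfForces G B F := by
  -- `n` counts the forces that are left.
  have key : ∀ (n : ℕ) (L : List (V × V)), (F \ {p | p ∈ L}).ncard = n → (∀ p ∈ L, p ∈ F) →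
      (∀ (k : ℕ) (hk : k < L.length),
        CanHop G (blueAfter B (L.take k)) (forcers (L.take k)) L[k].1 L[k].2) →
      IsSetOfForces G B F := by
    intro n
    induction n with
    | zero =>
      intro L hn hLF hL
      rw [Set.ncard_eq_zero (hfin.subset Set.sdiff_subset), Set.sdiff_eq_empty] at hn
      refine ⟨L, ⟨hL, fun v w h => h.2.1 ?_⟩, Set.Subset.antisymm hn hLF⟩
      rcases hblue w with hw | ⟨u, hu⟩
      · exact .inl hw
      · exact .inr ⟨u, hn hu⟩
    | succ n ih =>
      intro L hn hLF hL
      have hne : (F \ {p | p ∈ L}).Nonempty := by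
        rw [← Set.ncard_pos (hfin.subset Set.sdiff_subset)]
        omega
      obtain ⟨p, hpF, hpL, hp⟩ := hext L hLF (by simpa [Set.Nonempty] using hne)
      refine ih (L ++ [p]) ?_ ?_ ?_
      · have hset : F \ {q | q ∈ L ++ [p]} = (F \ {q | q ∈ L}) \ {p} := by
          ext q
          simp
          tauto
        have hpmem : p ∈ F \ {q | q ∈ L} := ⟨hpF, hpL⟩
        rw [hset, Set.ncard_sdiff_singleton_of_mem hpmem]
        omega
      · intro q hq
        rcases List.mem_append.1 hq with hq | hq
        · exact hLF q hq
        · exact List.mem_singleton.1 hq ▸ hpF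
      · intro k hk
        rw [List.length_append, List.length_singleton] at hk
        rcases Nat.lt_succ_iff_lt_or_eq.1 hk with hk' | rfl
        · rw [List.take_append_of_le_length hk'.le, List.getElem_append_left hk']
          exact hL k hk'
        · simpa using hp
  exact key _ [] rfl (by simp) (by simp)

end Forces

namespace IsThreading

variable {ι : Type*} {G : SimpleGraph V} {b : ℕ} {π : ι → ℕ → V}

/-- The forces along the rows of `π`: each entry forces the next one unless the two are equal. -/
def forces (π : ι → ℕ → V) : Set (V × V) :=
  {p | ∃ i j, p = (π i j, π i (j + 1)) ∧ π i j ≠ π i (j + 1)}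

/-- An entry that changes after column `j` does not recur. -/
lemma ne_of_lt (h : IsThreading G b π) {i i' : ι} {j j' : ℕ} (hne : π i j ≠ π i (j + 1))
    (hj : j < j') : π i j ≠ π i' j' := by
  intro he
  obtain rfl := h.row_eq he
  exact hne (h.convex he (Nat.le_succ j) hj).symm

/-- An entry that is new in column `j + 1` does not occur in an earlier column. -/
lemma succ_ne_of_le (h : IsThreading G b π) {i i' : ι} {j j' : ℕ} (hne : π i j ≠ π i (j + 1))
    (hj : j' ≤ j) : π i (j + 1) ≠ π i' j' := by
  intro he
  obtain rfl := h.row_eq he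
  exact hne ((h.convex he.symm hj (Nat.le_succ j)).trans he.symm)

lemma target_unique (h : IsThreading G b π) {v w w' : V} (hw : (v, w) ∈ forces π)
    (hw' : (v, w') ∈ forces π) : w = w' := by
  obtain ⟨i, j, he, hne⟩ := hw
  obtain ⟨i', j', he', hne'⟩ := hw'
  obtain ⟨rfl, rfl⟩ := Prod.ext_iff.1 he
  obtain ⟨he1, rfl⟩ := Prod.ext_iff.1 he'
  simp only at he1 ⊢
  obtain rfl := h.row_eq he1
  rcases lt_trichotomy j j' with hj | rfl | hj
  · exact absurd he1 (h.ne_of_lt hne hj)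
  · rfl
  · exact absurd he1.symm (h.ne_of_lt hne' hj)

lemma source_unique (h : IsThreading G b π) {v v' w : V} (hv : (v, w) ∈ forces π)
    (hv' : (v', w) ∈ forces π) : v = v' := by
  obtain ⟨i, j, he, hne⟩ := hv
  obtain ⟨i', j', he', hne'⟩ := hv'
  obtain ⟨rfl, rfl⟩ := Prod.ext_iff.1 he
  obtain ⟨rfl, he1⟩ := Prod.ext_iff.1 he'
  simp only at he1 ⊢
  obtain rfl := h.row_eq he1
  rcases lt_trichotomy j j' with hj | rfl | hj
  · exact absurd he1.symm (h.succ_ne_of_le hne' hj)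
  · rfl
  · exact absurd he1 (h.succ_ne_of_le hne hj)

/-- The neighbours of an entry that changes after column `j` occur in columns up to `j`. -/
lemma neighborSet_subset (h : IsThreading G b π) {i : ι} {j : ℕ} (hne : π i j ≠ π i (j + 1))
    {S : Set V} (hS : ∀ i', ∀ j' ≤ j, π i' j' ∈ S) : G.neighborSet (π i j) ⊆ S := by
  intro u hu
  obtain ⟨i₁, i₂, k, -, h1, rfl⟩ := h.adj hu
  exact hS _ _ (not_lt.1 fun hk => h.ne_of_lt hne hk h1.symm)

lemma mem_blueAt (h : IsThreading G b π) (n : ℕ) :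
    ∀ i, ∀ j ≤ n, π i j ∈ blueAt G (Set.range fun i => π i 0) (forces π) n := by
  induction n with
  | zero =>
    intro i j hj
    obtain rfl := Nat.le_zero.1 hj
    exact ⟨i, rfl⟩
  | succ n ih =>
    intro i j hj
    rcases Nat.le_succ_iff.1 hj with hj | rfl
    · exact .inl (ih i j hj)
    · by_cases hblue : π i (n + 1) ∈ blueAt G (Set.range fun i => π i 0) (forces π) n
      · exact .inl hblue
      · have hne : π i n ≠ π i (n + 1) := fun he => hblue (he ▸ ih i n le_rfl)
        have hmem : (π i n, π i (n + 1)) ∈ forces π := ⟨i, n, rfl, hne⟩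
        refine .inr ⟨π i n, hmem, ih i n le_rfl, hblue, ?_, h.neighborSet_subset hne ih⟩
        rintro ⟨y, hy, hy'⟩
        exact hblue (h.target_unique hmem hy' ▸ hy)

lemma isSetOfForces [Finite V] (h : IsThreading G b π) :
    IsSetOfForces G (Set.range fun i => π i 0) (forces π) := by
  classical
  refine isSetOfForces_of_extend (Set.toFinite _) (fun L hLF hex => ?_) fun w => ?_
  · -- The next force is one that leaves the least possible column.
    have hex' : ∃ j i, π i j ≠ π i (j + 1) ∧ (π i j, π i (j + 1)) ∉ L := by
      obtain ⟨_, ⟨i, j, rfl, hne⟩, hL⟩ := hex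
      exact ⟨j, i, hne, hL⟩
    obtain ⟨i, hne, hL⟩ := Nat.find_spec hex'
    have hmin : ∀ k < Nat.find hex', ∀ i, π i k ≠ π i (k + 1) → (π i k, π i (k + 1)) ∈ L :=
      fun k hk i hne => by
        by_contra hL
        exact Nat.find_min hex' hk ⟨i, hne, hL⟩
    generalize Nat.find hex' = j at hne hL hmin
    have hblue : ∀ i', ∀ k ≤ j, π i' k ∈ blueAfter (Set.range fun i => π i 0) L := by
      intro i' k
      induction k with
      | zero => exact fun _ => .inl ⟨i', rfl⟩
      | succ k ih =>
        intro hk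
        by_cases he : π i' k = π i' (k + 1)
        · exact he ▸ ih (by omega)
        · exact .inr ⟨_, hmin k hk i' he⟩
    have hmem : (π i j, π i (j + 1)) ∈ forces π := ⟨i, j, rfl, hne⟩
    refine ⟨_, hmem, hL, hblue i j le_rfl, ?_, ?_, h.neighborSet_subset hne hblue⟩
    · rintro (⟨i', hi'⟩ | ⟨v, hv⟩)
      · exact h.succ_ne_of_le hne (Nat.zero_le j) hi'.symm
      · exact hL (h.source_unique (hLF _ hv) hmem ▸ hv)
    · rintro ⟨w, hw⟩
      exact hL (h.target_unique (hLF _ hw) hmem ▸ hw)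
  · obtain ⟨i, j, -, rfl⟩ := h.surj w
    induction j with
    | zero => exact .inl ⟨i, rfl⟩
    | succ j ih =>
      by_cases he : π i j = π i (j + 1)
      · exact he ▸ ih
      · exact .inr ⟨_, i, j, rfl, he⟩

lemma propTime_le [Finite V] (h : IsThreading G b π) :
    propTime G (Set.range fun i => π i 0) ≤ b := by
  refine iInf₂_le_of_le _ h.isSetOfForces (iInf₂_le b ?_)
  rw [Set.eq_univ_iff_forall]
  intro v
  obtain ⟨i, j, hj, rfl⟩ := h.surj v
  exact h.mem_blueAt b i j hj

end IsThreading

/-! ### Throttling -/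

/-- The infima in the definition of the throttling number are attained. -/
lemma exists_of_throttlingNumber_le {G : SimpleGraph V} {t : ℕ} (h : throttlingNumber G ≤ t) :
    ∃ (B : Finset V) (F : Set (V × V)) (b : ℕ), IsSetOfForces G B F ∧
      blueAt G B F b = Set.univ ∧ B.card + b ≤ t := by
  have h' : throttlingNumber G < ((t + 1 : ℕ) : ℕ∞) :=
    h.trans_lt (by exact_mod_cast Nat.lt_succ_self t)
  obtain ⟨B, hB⟩ := iInf_lt_iff.1 h'
  have hne : propTime G (B : Set V) ≠ ⊤ := by
    intro htop
    simp [htop] at hB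
  obtain ⟨n, hn⟩ := ENat.ne_top_iff_exists.1 hne
  have hlt : propTime G (B : Set V) < ((n + 1 : ℕ) : ℕ∞) := by
    rw [← hn]
    exact_mod_cast Nat.lt_succ_self n
  obtain ⟨F, hF⟩ := iInf_lt_iff.1 hlt
  obtain ⟨hset, hF⟩ := iInf_lt_iff.1 hF
  obtain ⟨b, hb⟩ := iInf_lt_iff.1 hF
  obtain ⟨hblue, hb⟩ := iInf_lt_iff.1 hb
  refine ⟨B, F, b, hset, hblue, ?_⟩
  rw [← hn] at hB
  norm_cast at hB hb
  omega

lemma exists_isObtainable_of_throttlingNumber_le [Nonempty V] {G : SimpleGraph V} {t : ℕ}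
    (h : throttlingNumber G ≤ t) : ∃ a b : ℕ, 1 ≤ a ∧ a + b = t ∧ IsObtainable G a b := by
  obtain ⟨B, F, b, hF, hb, hle⟩ := exists_of_throttlingNumber_le h
  -- The number of columns is padded, so that the two parameters add up to `t`.
  have hb' : blueAt G B F (t - B.card) = Set.univ :=
    Set.univ_subset_iff.1 (hb ▸ blueAt_mono (by omega))
  have hthr := isThreading_chain hF hb'
  have hpos : 1 ≤ B.card := by
    obtain ⟨x, -⟩ := hthr.surj (Classical.arbitrary V)
    exact Finset.card_pos.2 ⟨x, x.2⟩
  exact ⟨B.card, t - B.card, hpos, by omega,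
    isObtainable_iff.2 ⟨_, hthr.comp_equiv B.equivFin.symm⟩⟩

lemma throttlingNumber_le_of_isObtainable [Finite V] {G : SimpleGraph V} {a b : ℕ}
    (h : IsObtainable G a b) : throttlingNumber G ≤ ((a + b : ℕ) : ℕ∞) := by
  classical
  obtain ⟨π, hπ⟩ := isObtainable_iff.1 h
  refine iInf_le_of_le (Finset.univ.image fun i => π i 0) ?_
  have hcoe : ((Finset.univ.image fun i => π i 0 : Finset V) : Set V) =
      Set.range fun i => π i 0 := by simp
  rw [hcoe, Nat.cast_add]
  refine add_le_add ?_ hπ.propTime_le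
  exact_mod_cast Finset.card_image_le.trans (Finset.card_fin a).le

end HoppingForcing

theorem mainTheorem2 {V : Type*} [Finite V] [Nonempty V] (G : SimpleGraph V)
    (t : ℕ) (ht : 0 < t) :
    HoppingForcing.throttlingNumber G ≤ (t : ℕ∞) ↔
      ∃ a b : ℕ, 1 ≤ a ∧ a + b = t ∧ HoppingForcing.IsObtainable G a b := by
  refine ⟨HoppingForcing.exists_isObtainable_of_throttlingNumber_le, ?_⟩
  rintro ⟨a, b, -, rfl, h⟩
  exact HoppingForcing.throttlingNumber_le_of_isObtainable h
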